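/- Let $H$ be the Horn matrix $$H=\begin{pmatrix}1&-1&1&1&-1\\-1&1&-1&1&1\\1&-1&1&-1&1\\1&1&-1&1&-1\\-1&1&1&-1&1\end{pmatrix},$$ and let $W\subseteq\mathbb R^{5\times5}$ be the linear subspace of all real matrices of the form $$\begin{pmatrix}y_{11}&0&0&y_{41}&y_{51}\\y_{12}&y_{22}&0&0&y_{52}\\y_{13}&y_{23}&y_{33}&0&0\\0&y_{24}&y_{34}&y_{44}&0\\0&0&y_{35}&y_{45}&y_{55}\end{pmatrix}.$$ Let $Z_{Horn}\subseteq W$ be the set of all matrices $DB$, where $D$ is a diagonal matrix with positive diagonal entries and $$B=\begin{pmatrix}1&0&0&y_4&y_5+1\\y_1+1&1&0&0&y_5\\y_1&y_2+1&1&0&0\\0&y_2&y_3+1&1&0\\0&0&y_3&y_4+1&1\end{pmatrix}\operatorname{diag}(z_1,z_2,z_3,z_4,z_5)$$ with positive real numbers $y_1,\dots,y_5,z_1,\dots,z_5$. Then $\dim W=15$, and the Zariski closure of $Z_{Horn}$ in $W$ (the set of common zeros in $W$ of all real polynomials in the $15$ coordinates of $W$ that vanish on $Z_{Horn}$) is the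 vanishing locus of the polynomial $s(X)=\det(H\circ X)$: $$\overline{Z_{Horn}}=\{X\in W:\det(H\circ X)=0\},$$ where $\circ$ denotes the Hadamard (entrywise) product. -/

import Mathlib

open scoped Matrix

namespace HornLocus

/-- The Horn matrix. -/
def hornMatrix : Matrix (Fin 5) (Fin 5) ℝ :=
  !![ 1, -1,  1,  1, -1;
     -1,  1, -1,  1,  1;
      1, -1,  1, -1,  1;
      1,  1, -1,  1, -1;
     -1,  1,  1, -1,  1]

/-- The position `(i, j)` (row `i`, column `j`) is allowed to carry a nonzero entry: column `j` is
supported in the rows `j`, `j + 1`, `j + 2`, taken modulo `5`. -/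
def InPattern (i j : Fin 5) : Prop := i = j ∨ i = j + 1 ∨ i = j + 2

/-- The linear space `W` of real `5 × 5` matrices with the shape
```
  *  0  0  *  *
  *  *  0  0  *
  *  *  *  0  0
  0  *  *  *  0
  0  0  *  *  *
```
-/
def W : Submodule ℝ (Matrix (Fin 5) (Fin 5) ℝ) where
  carrier := {X | ∀ i j, ¬ InPattern i j → X i j = 0}
  add_mem' := by
    intro X Y hX hY i j h
    simp [hX i j h, hY i j h]
  zero_mem' := by
    intro i j _
    rfl
  smul_mem' := by
    intro c X hX i j h
    simp [hX i j h]

/-- The fifteen positions of the pattern; they index the coordinates on `W`. -/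
abbrev Position : Type := {p : Fin 5 × Fin 5 // InPattern p.1 p.2}

/-- The fifteen coordinates of an element of `W`. -/
def coord (X : W) : Position → ℝ := fun p => X.1 p.1.1 p.1.2

/-- The coordinates identify `W` with the real affine space of dimension fifteen. -/
theorem coord_bijective : Function.Bijective coord := by
  classical
  constructor
  · intro X Y h
    apply Subtype.ext
    ext i j
    by_cases hp : InPattern i j
    · exact congrFun h ⟨(i, j), hp⟩
    · rw [X.2 i j hp, Y.2 i j hp]
  · intro v
    refine ⟨⟨fun i j => if hp : InPattern i j then v ⟨(i, j), hp⟩ else 0, ?_⟩, ?_⟩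
    · intro i j hp
      simp [hp]
    · funext p
      obtain ⟨⟨i, j⟩, hp⟩ := p
      change (if hp : InPattern i j then v ⟨(i, j), hp⟩ else 0) = _
      rw [dif_pos hp]

/-- The Zariski closure in `W` of a subset `S` of `W`: the common zeros in `W` of all real
polynomials, in the fifteen coordinates, that vanish on `S`. -/
def zariskiClosure (S : Set W) : Set W :=
  coord ⁻¹' MvPolynomial.zeroLocus ℝ (MvPolynomial.vanishingIdeal ℝ (coord '' S))

/-- The matrix `B`, with parameters `y` and `z`. -/
def factorMatrix (y z : Fin 5 → ℝ) : Matrix (Fin 5) (Fin 5) ℝ :=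
  !![      1,       0,       0,     y 3, y 4 + 1;
     y 0 + 1,       1,       0,       0,     y 4;
         y 0, y 1 + 1,       1,       0,       0;
           0,     y 1, y 2 + 1,       1,       0;
           0,       0,     y 2, y 3 + 1,       1] * Matrix.diagonal z

/-- Every product `D B` lies in `W`. -/
theorem diagonal_mul_factorMatrix_mem (d y z : Fin 5 → ℝ) :
    Matrix.diagonal d * factorMatrix y z ∈ W := by
  intro i j hp
  rw [Matrix.diagonal_mul, factorMatrix, Matrix.mul_diagonal]
  fin_cases i <;> fin_cases j <;> first | (exact absurd (by unfold InPattern; decide) hp) | simp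

/-- The set `Z_Horn` of all matrices `D B` with `D` a positive diagonal matrix and `B` as above with
positive parameters. -/
def ZHorn : Set W :=
  {X | ∃ d y z : Fin 5 → ℝ, (∀ i, 0 < d i) ∧ (∀ i, 0 < y i) ∧ (∀ i, 0 < z i) ∧
    X.1 = Matrix.diagonal d * factorMatrix y z}

end HornLocus

open Filter Topology

namespace HornLocus

/-! On the pattern `H` has signs `+, -, +` down each column, so the inverse diagonal of `D` is a
left kernel vector of `H ∘ DB`; this gives one inclusion. Conversely, a kernel vector `t` without
zeros exhibits `X` as such a product with real parameters of any sign, and polynomial identities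
extend from positive to all parameters (`band_scaledBand_mem_zariskiClosure`). If `t` has zeros, `X`
is a Euclidean limit of matrices with zero-free kernel vectors, and Zariski closed sets are
Euclidean closed (`band_mem_zariskiClosure_of_direction`, `exists_direction`). -/

instance decidableInPattern (i j : Fin 5) : Decidable (InPattern i j) :=
  inferInstanceAs (Decidable (i = j ∨ i = j + 1 ∨ i = j + 2))

theorem finrank_W : Module.finrank ℝ W = 15 := by
  let e : W →ₗ[ℝ] (Position → ℝ) :=
    { toFun := coord
      map_add' := fun _ _ => rfl
      map_smul' := fun _ _ => rfl }
  rw [(LinearEquiv.ofBijective e coord_bijective).finrank_eq, Module.finrank_fintype_fun_eq_card]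
  decide

/-- The element of `W` whose column `j` carries `M j 0`, `M j 1`, `M j 2` in the rows
`j`, `j + 1`, `j + 2`. -/
def band (M : Fin 5 → Fin 3 → ℝ) : W :=
  ⟨fun i j => if i = j then M j 0 else if i = j + 1 then M j 1 else if i = j + 2 then M j 2 else 0,
    by
      intro i j h
      simp only [InPattern, not_or] at h
      simp [h]⟩

theorem band_apply (M : Fin 5 → Fin 3 → ℝ) (i j : Fin 5) :
    (band M).1 i j =
      if i = j then M j 0 else if i = j + 1 then M j 1 else if i = j + 2 then M j 2 else 0 :=
  rfl

theorem band_surjective : Function.Surjective band := by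
  intro X
  refine ⟨fun j => ![X.1 j j, X.1 (j + 1) j, X.1 (j + 2) j], Subtype.ext ?_⟩
  ext i j
  rw [band_apply]
  split_ifs with h₀ h₁ h₂
  · simp [h₀]
  · simp [h₁]
  · simp [h₂]
  · exact (X.2 i j (by simp [InPattern, h₀, h₁, h₂])).symm

theorem continuous_coord_band : Continuous fun M => coord (band M) := by
  refine continuous_pi fun p => ?_
  change Continuous fun M : Fin 5 → Fin 3 → ℝ => (band M).1 p.1.1 p.1.2
  simp only [band_apply]
  split_ifs <;> fun_prop

/-- The entry in column `j` of the row vector `t (H ∘ band M)`. -/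
def pairing (t : Fin 5 → ℝ) (M : Fin 5 → Fin 3 → ℝ) (j : Fin 5) : ℝ :=
  t j * M j 0 - t (j + 1) * M j 1 + t (j + 2) * M j 2

theorem vecMul_horn_band (t : Fin 5 → ℝ) (M : Fin 5 → Fin 3 → ℝ) :
    t ᵥ* (hornMatrix ⊙ (band M).1) = pairing t M := by
  ext j
  simp only [Matrix.vecMul, dotProduct, Fin.sum_univ_five, Matrix.hadamard_apply, band_apply,
    pairing]
  fin_cases j <;> simp [hornMatrix] <;> ring

theorem det_horn_band_eq_zero_iff (M : Fin 5 → Fin 3 → ℝ) :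
    (hornMatrix ⊙ (band M).1).det = 0 ↔ ∃ t ≠ 0, pairing t M = 0 := by
  simp only [← Matrix.exists_vecMul_eq_zero_iff, vecMul_horn_band]

/-- The columns of `D B` in terms of the diagonal `d` of `D`, the diagonal `p` of `B`, and the
lower band `q` of `B`. -/
def scaledBand (d p q : Fin 5 → ℝ) (j : Fin 5) : Fin 3 → ℝ :=
  ![d j * p j, d (j + 1) * (p j + q j), d (j + 2) * q j]

theorem diagonal_mul_factorMatrix (d y z : Fin 5 → ℝ) :
    Matrix.diagonal d * factorMatrix y z = (band (scaledBand d z (fun j => y j * z j))).1 := by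
  ext i j
  rw [Matrix.diagonal_mul, factorMatrix, Matrix.mul_diagonal, band_apply]
  fin_cases i <;> fin_cases j <;> simp [scaledBand, -mul_eq_mul_left_iff] <;> ring

theorem band_scaledBand_mem_ZHorn {d p q : Fin 5 → ℝ} (hd : ∀ i, 0 < d i) (hp : ∀ i, 0 < p i)
    (hq : ∀ i, 0 < q i) : band (scaledBand d p q) ∈ ZHorn := by
  refine ⟨d, fun j => q j / p j, p, hd, fun i => div_pos (hq i) (hp i), hp, ?_⟩
  rw [diagonal_mul_factorMatrix]
  simp only [div_mul_cancel₀ _ (hp _).ne']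

theorem det_horn_eq_zero_of_mem_ZHorn {X : W} (hX : X ∈ ZHorn) :
    (hornMatrix ⊙ X.1).det = 0 := by
  obtain ⟨d, y, z, hd, -, -, h⟩ := hX
  rw [h, diagonal_mul_factorMatrix, det_horn_band_eq_zero_iff]
  refine ⟨fun i => (d i)⁻¹, fun h0 => (inv_ne_zero (hd 0).ne') (congrFun h0 0), ?_⟩
  ext j
  simp [pairing, scaledBand, inv_mul_cancel_left₀ (hd _).ne']

/-- The polynomial `det (H ∘ X)` in the coordinates of `W`. -/
noncomputable def hornPolynomial : MvPolynomial Position ℝ :=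
  Matrix.det (Matrix.of fun i j : Fin 5 =>
    if h : InPattern i j then MvPolynomial.C (hornMatrix i j) * MvPolynomial.X ⟨(i, j), h⟩ else 0)

theorem aeval_hornPolynomial (X : W) :
    MvPolynomial.aeval (coord X) hornPolynomial = (hornMatrix ⊙ X.1).det := by
  rw [hornPolynomial, AlgHom.map_det]
  congr 1
  ext i j
  by_cases h : InPattern i j
  · simp [h, coord]
  · simp [h, X.2 i j h]

theorem mem_zariskiClosure_iff {S : Set W} {X : W} :
    X ∈ zariskiClosure S ↔ ∀ f : MvPolynomial Position ℝ,
      (∀ Y ∈ S, MvPolynomial.aeval (coord Y) f = 0) → MvPolynomial.aeval (coord X) f = 0 := by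
  simp only [zariskiClosure, Set.mem_preimage, MvPolynomial.mem_zeroLocus_iff,
    MvPolynomial.mem_vanishingIdeal_iff, Set.forall_mem_image]

theorem isClosed_band_preimage_zariskiClosure (S : Set W) :
    IsClosed (band ⁻¹' zariskiClosure S) := by
  have : band ⁻¹' zariskiClosure S = ⋂ (f : MvPolynomial Position ℝ)
      (_ : ∀ Y ∈ S, MvPolynomial.aeval (coord Y) f = 0),
      {M | MvPolynomial.aeval (coord (band M)) f = 0} := by
    ext M
    simp [mem_zariskiClosure_iff]
  rw [this]
  refine isClosed_iInter fun f => isClosed_iInter fun _ => isClosed_eq ?_ continuous_const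
  exact (MvPolynomial.continuous_eval f).comp continuous_coord_band

/-- Signs do not matter: a polynomial vanishing on the positive orthant is zero. -/
theorem band_scaledBand_mem_zariskiClosure (d p q : Fin 5 → ℝ) :
    band (scaledBand d p q) ∈ zariskiClosure ZHorn := by
  rw [mem_zariskiClosure_iff]
  intro f hf
  let x (k : Fin 3) (i : Fin 5) : MvPolynomial (Fin 3 × Fin 5) ℝ := MvPolynomial.X (k, i)
  -- The pullback of `f` along the parametrization.
  let F : MvPolynomial (Fin 3 × Fin 5) ℝ := MvPolynomial.aeval (fun r : Position =>
    if r.1.1 = r.1.2 then x 0 r.1.2 * x 1 r.1.2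
    else if r.1.1 = r.1.2 + 1 then x 0 (r.1.2 + 1) * (x 1 r.1.2 + x 2 r.1.2)
    else if r.1.1 = r.1.2 + 2 then x 0 (r.1.2 + 2) * x 2 r.1.2 else 0) f
  have hF (v : Fin 3 × Fin 5 → ℝ) : MvPolynomial.eval v F =
      MvPolynomial.aeval (coord (band (scaledBand (fun i => v (0, i)) (fun i => v (1, i))
        (fun i => v (2, i))))) f := by
    change MvPolynomial.aeval v F = _
    simp only [F]
    rw [← AlgHom.comp_apply, MvPolynomial.comp_aeval]
    congr 2
    ext r
    simp only [coord, band_apply, scaledBand, x]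
    split_ifs <;> simp
  have hF0 : F = 0 := by
    refine MvPolynomial.funext_set (fun _ => Set.Ioi (0 : ℝ)) (fun _ => Set.Ioi_infinite 0) ?_
    intro v hv
    have hv' : ∀ k, 0 < v k := fun k => hv k trivial
    rw [hF, map_zero]
    exact hf _ (band_scaledBand_mem_ZHorn (fun _ => hv' _) (fun _ => hv' _) (fun _ => hv' _))
  have h := hF fun k => ![d, p, q] k.1 k.2
  rw [hF0, map_zero] at h
  simpa using h.symm

/-! ### From kernel vectors without zeros to arbitrary ones -/

theorem band_mem_zariskiClosure_of_forall_ne_zero {t : Fin 5 → ℝ} {M : Fin 5 → Fin 3 → ℝ}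
    (ht : ∀ i, t i ≠ 0) (h : pairing t M = 0) : band M ∈ zariskiClosure ZHorn := by
  convert band_scaledBand_mem_zariskiClosure (fun i => (t i)⁻¹) (fun j => t j * M j 0)
    (fun j => t (j + 2) * M j 2) using 2
  ext j k
  have hj : t j * M j 0 + t (j + 2) * M j 2 = t (j + 1) * M j 1 := by
    have := congrFun h j
    simp only [pairing, Pi.zero_apply] at this
    linarith
  fin_cases k <;> simp [scaledBand, hj, inv_mul_cancel_left₀ (ht _)]

/-- A left kernel vector `t` can be moved in a direction `e` that is orthogonal to the columns on
which `t` vanishes. -/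
theorem band_mem_zariskiClosure_of_direction {t e : Fin 5 → ℝ} {M : Fin 5 → Fin 3 → ℝ}
    (h : pairing t M = 0) (he : ∀ i, e i ≠ 0)
    (hfree : ∀ j, (t j = 0 ∧ t (j + 1) = 0 ∧ t (j + 2) = 0) → pairing e M j = 0) :
    band M ∈ zariskiClosure ZHorn := by
  let τ (s : ℝ) (i : Fin 5) : ℝ := t i + s * e i
  let N (s : ℝ) (j : Fin 5) : ℝ := τ s j ^ 2 + τ s (j + 1) ^ 2 + τ s (j + 2) ^ 2
  -- Each column is projected onto the hyperplane that makes `τ s` a kernel vector.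
  let M' (s : ℝ) (j : Fin 5) (k : Fin 3) : ℝ :=
    M j k - s * (pairing e M j / N s j) * ![τ s j, -τ s (j + 1), τ s (j + 2)] k
  have hM0 : M' 0 = M := by
    ext j k
    simp [M']
  have hcont : Tendsto M' (𝓝[≠] 0) (𝓝 M) := by
    rw [← hM0]
    refine tendsto_nhdsWithin_of_tendsto_nhds (ContinuousAt.tendsto ?_)
    refine continuousAt_pi.2 fun j => continuousAt_pi.2 fun k => ?_
    have hq : ContinuousAt (fun s => pairing e M j / N s j) 0 := by
      -- `N 0 j` vanishes only for these columns, where the numerator is identically zero.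
      by_cases hj : t j = 0 ∧ t (j + 1) = 0 ∧ t (j + 2) = 0
      · simp only [hfree j hj, zero_div]
        exact continuousAt_const
      · refine continuousAt_const.div (by fun_prop) ?_
        contrapose! hj
        simp only [N, τ, zero_mul, add_zero] at hj
        refine ⟨?_, ?_, ?_⟩ <;> nlinarith [sq_nonneg (t j), sq_nonneg (t (j + 1)),
          sq_nonneg (t (j + 2))]
    have hk : ContinuousAt (fun s => ![τ s j, -τ s (j + 1), τ s (j + 2)] k) 0 := by
      fin_cases k <;> simp [τ] <;> fun_prop
    exact continuousAt_const.sub ((continuousAt_id.mul hq).mul hk)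
  have hτ : ∀ᶠ s in 𝓝[≠] (0 : ℝ), ∀ i, τ s i ≠ 0 := by
    refine eventually_all.2 fun i => ?_
    by_cases hi : t i = 0
    · filter_upwards [self_mem_nhdsWithin] with s hs
      simpa [τ, hi, he i] using hs
    · have : ContinuousAt (fun s => τ s i) 0 := by fun_prop
      exact (this.eventually_ne (by simpa [τ] using hi)).filter_mono nhdsWithin_le_nhds
  refine (isClosed_band_preimage_zariskiClosure ZHorn).mem_of_tendsto hcont ?_
  filter_upwards [hτ] with s hs
  refine band_mem_zariskiClosure_of_forall_ne_zero hs ?_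
  ext j
  have hN : N s j ≠ 0 := by
    have := pow_pos (abs_pos.2 (hs j)) 2
    rw [sq_abs] at this
    positivity
  have hj : pairing t M j = 0 := congrFun h j
  have hsplit : pairing (τ s) (M' s) j =
      pairing t M j + s * pairing e M j - s * (pairing e M j / N s j) * N s j := by
    simp only [pairing, M', N, τ, Matrix.cons_val]
    ring
  rw [hsplit, hj, mul_assoc, div_mul_cancel₀ _ hN]
  simp

/-- Two adjacent columns with nonzero entries have a common orthogonal vector without zeros. -/
theorem exists_direction (u v : Fin 3 → ℝ) (hu : ∀ k, u k ≠ 0) (hv : ∀ k, v k ≠ 0) :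
    ∃ e : Fin 5 → ℝ, (∀ i, e i ≠ 0) ∧ e 0 * u 0 - e 1 * u 1 + e 2 * u 2 = 0 ∧
      e 1 * v 0 - e 2 * v 1 + e 3 * v 2 = 0 := by
  let e₁ (p : ℝ) : ℝ := (p * v 1 - v 2) / v 0
  let e₀ (p : ℝ) : ℝ := (e₁ p * u 1 - p * u 2) / u 0
  -- With `e 2 = p` and `e 3 = 1`, the equations give `e 1`, then `e 0`; both have nonzero limits as
  -- `p → 0`.
  have h₁ : ∀ᶠ p in 𝓝[≠] (0 : ℝ), e₁ p ≠ 0 := by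
    have : ContinuousAt e₁ 0 := by fun_prop
    exact (this.eventually_ne (by simp [e₁, hv])).filter_mono nhdsWithin_le_nhds
  have h₀ : ∀ᶠ p in 𝓝[≠] (0 : ℝ), e₀ p ≠ 0 := by
    have : ContinuousAt e₀ 0 := by fun_prop
    exact (this.eventually_ne (by simp [e₀, e₁, hv, hu])).filter_mono nhdsWithin_le_nhds
  obtain ⟨p, hp₀, hp₁, hp⟩ := (h₀.and (h₁.and self_mem_nhdsWithin)).exists
  refine ⟨![e₀ p, e₁ p, p, 1, 1], ?_, ?_, ?_⟩
  · intro i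
    fin_cases i
    · exact hp₀
    · exact hp₁
    · exact hp
    · exact one_ne_zero
    · exact one_ne_zero
  · have : e₀ p * u 0 = e₁ p * u 1 - p * u 2 := div_mul_cancel₀ _ (hu 0)
    simp [this]
  · have : e₁ p * v 0 = p * v 1 - v 2 := div_mul_cancel₀ _ (hv 0)
    simp [this]

theorem band_mem_zariskiClosure_of_pairing {t : Fin 5 → ℝ} {M : Fin 5 → Fin 3 → ℝ}
    (ht : t ≠ 0) (h : pairing t M = 0) : band M ∈ zariskiClosure ZHorn := by
  classical
  obtain ⟨i, hi⟩ := Function.ne_iff.1 ht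
  let free (j : Fin 5) : Prop := t j = 0 ∧ t (j + 1) = 0 ∧ t (j + 2) = 0
  -- Free columns are unconstrained by `t`, so their entries may be made nonzero.
  let M' (s : ℝ) (j : Fin 5) (k : Fin 3) : ℝ := if free j then M j k + s else M j k
  have hM0 : M' 0 = M := by
    ext j k
    simp [M']
  have hcont : Tendsto M' (𝓝[≠] 0) (𝓝 M) := by
    have : Continuous M' := by
      refine continuous_pi fun j => continuous_pi fun k => ?_
      simp only [M']
      split_ifs <;> fun_prop
    simpa only [hM0] using tendsto_nhdsWithin_of_tendsto_nhds (this.tendsto 0)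
  have hne : ∀ᶠ s in 𝓝[≠] (0 : ℝ), ∀ j k, M j k + s ≠ 0 := by
    refine eventually_all.2 fun j => eventually_all.2 fun k => ?_
    by_cases hjk : M j k = 0
    · filter_upwards [self_mem_nhdsWithin] with s hs
      simpa [hjk] using hs
    · have : ContinuousAt (fun s => M j k + s) 0 := by fun_prop
      exact (this.eventually_ne (by simpa using hjk)).filter_mono nhdsWithin_le_nhds
  refine (isClosed_band_preimage_zariskiClosure ZHorn).mem_of_tendsto hcont ?_
  filter_upwards [hne] with s hs
  obtain ⟨e, he, he₁, he₂⟩ := exists_direction (fun k => M (i + 1) k + s)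
    (fun k => M (i + 2) k + s) (hs _) (hs _)
  refine band_mem_zariskiClosure_of_direction (t := t) (e := fun k => e (k - (i + 1))) ?_
    (fun k => he _) ?_
  · ext j
    have hj : pairing t M j = 0 := congrFun h j
    by_cases hf : free j
    · simp [pairing, hf.1, hf.2.1, hf.2.2]
    · simpa [pairing, M', hf] using hj
  · intro j hj
    -- As `t i ≠ 0`, only the two adjacent columns that avoid row `i` can be free.
    have hcases : j = i + 1 ∨ j = i + 2 ∨ i = j ∨ i = j + 1 ∨ i = j + 2 := by
      clear * -
      revert i j
      decide
    have hfj : free j := hj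
    rcases hcases with rfl | rfl | rfl | rfl | rfl
    · have e₁ : i + 1 - (i + 1) = 0 := by abel
      have e₂ : i + 1 + 1 - (i + 1) = 1 := by abel
      have e₃ : i + 1 + 2 - (i + 1) = 2 := by abel
      simpa only [pairing, M', if_pos hfj, e₁, e₂, e₃] using he₁
    · have e₁ : i + 2 - (i + 1) = 1 := by clear * -; revert i; decide
      have e₂ : i + 2 + 1 - (i + 1) = 2 := by clear * -; revert i; decide
      have e₃ : i + 2 + 2 - (i + 1) = 3 := by clear * -; revert i; decide
      simpa only [pairing, M', if_pos hfj, e₁, e₂, e₃] using he₂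
    · exact absurd hj.1 hi
    · exact absurd hj.2.1 hi
    · exact absurd hj.2.2 hi

end HornLocus

theorem mainTheorem2 :
    Module.finrank ℝ HornLocus.W = 15 ∧
      HornLocus.zariskiClosure HornLocus.ZHorn =
        {X : HornLocus.W |
          (HornLocus.hornMatrix ⊙ (X : Matrix (Fin 5) (Fin 5) ℝ)).det = 0} := by
  refine ⟨HornLocus.finrank_W, Set.Subset.antisymm (fun X hX => ?_) (fun X hX => ?_)⟩
  · rw [Set.mem_ofPred_eq, ← HornLocus.aeval_hornPolynomial]
    refine HornLocus.mem_zariskiClosure_iff.1 hX _ fun Y hY => ?_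
    rw [HornLocus.aeval_hornPolynomial, HornLocus.det_horn_eq_zero_of_mem_ZHorn hY]
  · obtain ⟨M, rfl⟩ := HornLocus.band_surjective X
    obtain ⟨t, ht, h⟩ := (HornLocus.det_horn_band_eq_zero_iff M).1 hX
    exact HornLocus.band_mem_zariskiClosure_of_pairing ht h
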